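/- Let $\mathcal A$ and $\mathcal B$ be Grothendieck categories and let $\Gamma=(F,G,\eta,\rho)$ be a left wide Morita context between them: $F:\mathcal B\to\mathcal A$ and $G:\mathcal A\to\mathcal B$ are left exact functors and $\eta:1_{\mathcal A}\to F\circ G$, $\rho:1_{\mathcal B}\to G\circ F$ are natural transformations with $G\eta=\rho G$ and $F\rho=\eta F$. Let $\mathcal C_\Gamma=\{M\in\mathcal A\mid \eta(M)=0\}$ and $\mathcal D_\Gamma=\{N\in\mathcal B\mid \rho(N)=0\}$, and let $\overline{\mathcal C_\Gamma}$ and $\overline{\mathcal D_\Gamma}$ be the smallest localizing subcategories (full subcategories closed under subobjects, quotient objects, extensions and arbitrary direct sums) of $\mathcal A$ and $\mathcal B$ that contain $\mathcal C_\Gamma$ and $\mathcal D_\Gamma$, respectively. For a localizing subcategory $\mathcal L$ of a Grothendieck category, an object $M$ is called $\mathcal L$-closed if every subobject of $M$ that belongs to $\mathcal L$ is zero, and, for every object $X$ and every subobject $X'\le X$ with $X/X'\in\mathcal L$, every morphism $X'\to M$ extends to a morphism $X\to M$. Suppose that $F$ and $G$ commute with direct limits. Then the quotient categories $\mathcal A/\overline{\mathcal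 C_\Gamma}$ and $\mathcal B/\overline{\mathcal D_\Gamma}$ are equivalent via the restrictions of $F$ and $G$. That is, the canonical functors to $\mathcal A/\overline{\mathcal C_\Gamma}$ and $\mathcal B/\overline{\mathcal D_\Gamma}$ restrict to equivalences from the full subcategories of $\overline{\mathcal C_\Gamma}$-closed objects of $\mathcal A$ and of $\overline{\mathcal D_\Gamma}$-closed objects of $\mathcal B$; the functor $G$ sends $\overline{\mathcal C_\Gamma}$-closed objects to $\overline{\mathcal D_\Gamma}$-closed objects and $F$ sends $\overline{\mathcal D_\Gamma}$-closed objects to $\overline{\mathcal C_\Gamma}$-closed objects; the restrictions of $G$ and $F$ to these subcategories are mutually quasi-inverse equivalences; and, through the identifications above, they correspond to mutually quasi-inverse equivalences between $\mathcal A/\overline{\mathcal C_\Gamma}$ and $\mathcal B/\overline{\mathcal D_\Gamma}$. -/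

import Mathlib

open CategoryTheory CategoryTheory.Limits

universe w v v₁ v₂ u u₁ u₂

namespace WideMorita

section LocalizingSubcategories

variable {A : Type u} [Category.{v} A] [Abelian A]

/-- A (full) subcategory of an abelian category is localizing if it is closed under subobjects,
quotients, extensions (and contains zero), and arbitrary direct sums; the direct sums are
indexed by the types of the universe `w` relative to which `A` is a Grothendieck category. -/
class IsLocalizing (P : ObjectProperty A) : Prop extends P.IsSerreClass where
  closedUnderDirectSums : ∀ J : Type w, P.IsClosedUnderColimitsOfShape (Discrete J)

/-- The smallest localizing subcategory containing `P`. -/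
def localizingClosure (P : ObjectProperty A) : ObjectProperty A := fun X ↦
  ∀ Q : ObjectProperty A, IsLocalizing.{w} Q → P ≤ Q → Q X

theorem le_localizingClosure (P : ObjectProperty A) : P ≤ localizingClosure.{w} P :=
  fun _ hX _ _ hPQ ↦ hPQ _ hX

instance isLocalizing_localizingClosure (P : ObjectProperty A) :
    IsLocalizing.{w} (localizingClosure.{w} P) where
  exists_zero := ⟨_, isZero_zero A, fun Q hQ _ ↦ Q.prop_of_isZero (isZero_zero A)⟩
  prop_of_mono f _ hY := fun Q hQ hPQ ↦ Q.prop_of_mono f (hY Q hQ hPQ)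
  prop_of_epi f _ hX := fun Q hQ hPQ ↦ Q.prop_of_epi f (hX Q hQ hPQ)
  prop_X₂_of_shortExact hS h₁ h₃ := fun Q hQ hPQ ↦
    Q.prop_X₂_of_shortExact hS (h₁ Q hQ hPQ) (h₃ Q hQ hPQ)
  closedUnderDirectSums J :=
    ⟨fun X ⟨hX⟩ Q hQ hPQ ↦
      have := hQ.closedUnderDirectSums J
      (hX.ofLE (fun _ hY ↦ hY Q hQ hPQ)).prop⟩

theorem localizingClosure_le (P Q : ObjectProperty A) [IsLocalizing.{w} Q] (h : P ≤ Q) :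
    localizingClosure.{w} P ≤ Q :=
  fun _ hX ↦ hX Q inferInstance h

/-- `M` is `P`-torsion free: every subobject of `M` which belongs to `P` is zero. -/
def IsTorsionFree (P : ObjectProperty A) (M : A) : Prop :=
  ∀ ⦃X : A⦄ (i : X ⟶ M) [Mono i], P X → IsZero X

/-- `M` is `P`-injective: for every subobject `X'` of any object `X` such that `X / X'` belongs
to `P`, every morphism `X' ⟶ M` extends to `X`. -/
def IsRelInjective (P : ObjectProperty A) (M : A) : Prop :=
  ∀ ⦃X' X : A⦄ (i : X' ⟶ X) [Mono i], P (cokernel i) →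
    ∀ f : X' ⟶ M, ∃ g : X ⟶ M, i ≫ g = f

/-- The `P`-closed objects: those which are both `P`-torsion free and `P`-injective. -/
def closedObjects (P : ObjectProperty A) : ObjectProperty A := fun M ↦
  IsTorsionFree P M ∧ IsRelInjective P M

/-- Gabriel's quotient category `A / P` of an abelian category by a Serre class: the localization
of `A` at the morphisms whose kernel and cokernel belong to `P`. -/
abbrev QuotientCategory (P : ObjectProperty A) [P.IsSerreClass] :=
  P.isoModSerre.Localization

/-- The canonical functor `A ⥤ A / P`. -/
noncomputable abbrev toQuotient (P : ObjectProperty A) [P.IsSerreClass] : A ⥤ QuotientCategory P :=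
  P.isoModSerre.Q

/-- The restriction of the canonical functor `A ⥤ A / P` to the full subcategory of `P`-closed
objects. -/
noncomputable abbrev closedToQuotient (P : ObjectProperty A) [P.IsSerreClass] :
    (closedObjects P).FullSubcategory ⥤ QuotientCategory P :=
  (closedObjects P).ι ⋙ toQuotient P

end LocalizingSubcategories

/-- A left wide Morita context `(F, G, η, ρ)` between the abelian categories `A` and `B`.
Left exactness is preservation of finite limits; it implies that `F` and `G` are additive.
Note that `G ⋙ F` is the composite "`F` after `G`". -/
structure LeftWideMoritaContext (A : Type u₁) [Category.{v₁} A] [Abelian A]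
    (B : Type u₂) [Category.{v₂} B] [Abelian B] where
  F : B ⥤ A
  G : A ⥤ B
  leftExact_F : PreservesFiniteLimits F
  leftExact_G : PreservesFiniteLimits G
  η : 𝟭 A ⟶ G ⋙ F
  ρ : 𝟭 B ⟶ F ⋙ G
  map_η : ∀ M : A, G.map (η.app M) = ρ.app (G.obj M)
  map_ρ : ∀ N : B, F.map (ρ.app N) = η.app (F.obj N)

namespace LeftWideMoritaContext

variable {A : Type u₁} [Category.{v₁} A] [Abelian A] {B : Type u₂} [Category.{v₂} B] [Abelian B]

/-- The subcategory `C_Γ` of `A`: the objects at which `η` vanishes. -/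
def C (Γ : LeftWideMoritaContext A B) : ObjectProperty A := fun M ↦ Γ.η.app M = 0

/-- The subcategory `D_Γ` of `B`: the objects at which `ρ` vanishes. -/
def D (Γ : LeftWideMoritaContext A B) : ObjectProperty B := fun N ↦ Γ.ρ.app N = 0

/-- The smallest localizing subcategory of `A` containing `C_Γ`. -/
abbrev Cbar (Γ : LeftWideMoritaContext A B) : ObjectProperty A := localizingClosure.{w} Γ.C

/-- The smallest localizing subcategory of `B` containing `D_Γ`. -/
abbrev Dbar (Γ : LeftWideMoritaContext A B) : ObjectProperty B := localizingClosure.{w} Γ.D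

end LeftWideMoritaContext

end WideMorita

/-! The composite `T = G ⋙ F`, pointed by `η`, satisfies `T η = η T`, because `G η = ρ G` and `F ρ =
η F`; likewise for `F ⋙ G` and `ρ`. So everything about closed objects reduces to one left exact
pointed endofunctor `T` with `T η = η T` that commutes with filtered colimits.

Let `L` be the colimit of `1 ⟶ T ⟶ T² ⟶ ⋯`. It is left exact, and `η` is invertible at every `L X`.
The objects `X` whose unit `X ⟶ L X` vanishes are exactly those killed by `L`. They form a
localizing class containing the kernel class of `η`, and each of them is the union of the kernels of
`X ⟶ Tⁿ X`, which are iterated extensions of objects of that class. Hence this class is the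
localizing closure.

The closed objects are therefore those at which `η` is invertible, and `X ⟶ L X` is a closed
envelope, so they model the quotient category. On closed objects `η` and `ρ` are isomorphisms, which
makes `F` and `G` quasi-inverse. -/

namespace WideMorita

/-! ### Well-pointed endofunctors and the colimit of their iterates -/

section WellPointed

variable {A : Type u} [Category.{v} A]

/-- The `n`-th iterate of an endofunctor. -/
@[reducible] def iterateFunctor (T : A ⥤ A) : ℕ → (A ⥤ A)
  | 0 => 𝟭 A
  | n + 1 => iterateFunctor T n ⋙ T

variable {T : A ⥤ A} (η : 𝟭 A ⟶ T)

/-- The morphism between consecutive iterates of an endofunctor given by a pointing. -/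
def iterateStep (n : ℕ) (X : A) : (iterateFunctor T n).obj X ⟶ (iterateFunctor T (n + 1)).obj X :=
  η.app ((iterateFunctor T n).obj X)

/-- The functor sending `X` to the sequence `X ⟶ T X ⟶ T (T X) ⟶ ⋯` given by the pointing. -/
def iterateSequence : A ⥤ (ℕ ⥤ A) where
  obj X := Functor.ofSequence (fun n ↦ iterateStep η n X)
  map {X Y} f := NatTrans.ofSequence (fun n ↦ (iterateFunctor T n).map f) (fun n ↦ by
    rw [Functor.ofSequence_map_homOfLE_succ, Functor.ofSequence_map_homOfLE_succ]
    exact (η.naturality ((iterateFunctor T n).map f)).symm)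

variable (T) in
instance preservesFiniteLimits_iterateFunctor [PreservesFiniteLimits T] :
    ∀ n, PreservesFiniteLimits (iterateFunctor T n)
  | 0 => inferInstanceAs (PreservesFiniteLimits (𝟭 A))
  | n + 1 =>
    have := preservesFiniteLimits_iterateFunctor n
    inferInstanceAs (PreservesFiniteLimits (iterateFunctor T n ⋙ T))

instance [HasFiniteLimits A] [PreservesFiniteLimits T] :
    PreservesFiniteLimits (iterateSequence η) :=
  preservesFiniteLimits_of_evaluation _ fun n ↦
    preservesFiniteLimits_of_natIso (F := iterateFunctor T n)
      (NatIso.ofComponents (fun _ ↦ Iso.refl _)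
        (fun _ ↦ (Category.comp_id _).trans (Category.id_comp _).symm))

variable {η} in
lemma isIso_pointing_iterateFunctor (hη : ∀ X, T.map (η.app X) = η.app (T.obj X)) {M : A}
    [IsIso (η.app M)] :
    ∀ n, IsIso (η.app ((iterateFunctor T n).obj M))
  | 0 => ‹_›
  | n + 1 => by
    have := isIso_pointing_iterateFunctor hη (M := M) n
    change IsIso (η.app (T.obj ((iterateFunctor T n).obj M)))
    rw [← hη]
    infer_instance

variable [HasColimitsOfShape ℕ A]

/-- The colimit of the iterates of a pointed endofunctor. -/
noncomputable def iterateColimit : A ⥤ A := iterateSequence η ⋙ colim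

instance [HasFiniteLimits A] [PreservesFiniteLimits T] [HasExactColimitsOfShape ℕ A] :
    PreservesFiniteLimits (iterateColimit η) :=
  inferInstanceAs (PreservesFiniteLimits (iterateSequence η ⋙ colim))

/-- The canonical morphism from the `n`-th iterate to the colimit of all iterates. -/
noncomputable def toIterateColimit (n : ℕ) (X : A) :
    (iterateFunctor T n).obj X ⟶ (iterateColimit η).obj X :=
  colimit.ι ((iterateSequence η).obj X) n

/-- The unit of the colimit of the iterates. -/
noncomputable def iterateUnit (X : A) : X ⟶ (iterateColimit η).obj X :=
  toIterateColimit η 0 X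

variable {η}

lemma iterateColimit_hom_ext {X Y : A} {f g : (iterateColimit η).obj X ⟶ Y}
    (h : ∀ n, toIterateColimit η n X ≫ f = toIterateColimit η n X ≫ g) : f = g :=
  colimit.hom_ext h

variable (η)

lemma pointing_toIterateColimit (n : ℕ) (X : A) :
    iterateStep η n X ≫ toIterateColimit η (n + 1) X =
      toIterateColimit η n X := by
  have := colimit.w ((iterateSequence η).obj X) (homOfLE (Nat.le_add_right n 1))
  rwa [iterateSequence, Functor.ofSequence_map_homOfLE_succ] at this

lemma toIterateColimit_naturality (n : ℕ) {X Y : A} (f : X ⟶ Y) :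
    toIterateColimit η n X ≫ (iterateColimit η).map f =
      (iterateFunctor T n).map f ≫ toIterateColimit η n Y :=
  ι_colimMap _ _

lemma iterateUnit_naturality {X Y : A} (f : X ⟶ Y) :
    iterateUnit η X ≫ (iterateColimit η).map f = f ≫ iterateUnit η Y :=
  toIterateColimit_naturality η 0 f

variable {η} (hη : ∀ X, T.map (η.app X) = η.app (T.obj X))

include hη

lemma toIterateColimit_pointing (n : ℕ) (X : A) :
    toIterateColimit η (n + 1) X ≫ η.app ((iterateColimit η).obj X) =
      T.map (toIterateColimit η n X) := by
  refine (η.naturality (toIterateColimit η (n + 1) X)).trans ?_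
  refine (congrArg (· ≫ _) (hη ((iterateFunctor T n).obj X)).symm).trans ?_
  exact (T.map_comp _ _).symm.trans (congrArg T.map (pointing_toIterateColimit η n X))

/-- `T` carries the colimit to the colimit of the shifted sequence: the transition maps `T η` agree
with `η T`. The inverse is the comparison induced by the insertions of index `n + 1`. -/
lemma isIso_pointing_iterateColimit [PreservesColimitsOfShape ℕ T] (X : A) :
    IsIso (η.app ((iterateColimit η).obj X)) := by
  let c : Cocone ((iterateSequence η).obj X ⋙ T) :=
    { pt := (iterateColimit η).obj X
      ι := NatTrans.ofSequence (fun n ↦ toIterateColimit η (n + 1) X) (fun n ↦ by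
        dsimp [iterateSequence]
        rw [Functor.ofSequence_map_homOfLE_succ]
        refine (congrArg (· ≫ _) (hη ((iterateFunctor T n).obj X))).trans ?_
        exact (pointing_toIterateColimit η (n + 1) X).trans (Category.comp_id _).symm) }
  let hc := isColimitOfPreserves T (colimit.isColimit ((iterateSequence η).obj X))
  let d : T.obj ((iterateColimit η).obj X) ⟶ (iterateColimit η).obj X := hc.desc c
  have fac (n : ℕ) : T.map (toIterateColimit η n X) ≫ d = toIterateColimit η (n + 1) X :=
    hc.fac c n
  refine ⟨d, iterateColimit_hom_ext fun n ↦ ?_, hc.hom_ext fun n ↦ ?_⟩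
  · refine (η.naturality_assoc (toIterateColimit η n X) _).trans ?_
    rw [fac]
    exact (pointing_toIterateColimit η n X).trans (Category.comp_id _).symm
  · change T.map (toIterateColimit η n X) ≫ d ≫ _ = T.map (toIterateColimit η n X) ≫ 𝟙 _
    rw [reassoc_of% fac, toIterateColimit_pointing hη, Category.comp_id]

lemma exists_iterateUnit_retraction (M : A) [IsIso (η.app M)] :
    ∃ r : (iterateColimit η).obj M ⟶ M, iterateUnit η M ≫ r = 𝟙 M := by
  have := isIso_pointing_iterateFunctor hη (M := M)
  -- All the transition maps starting at `M` are invertible; `p n` composes their inverses.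
  let p : ∀ n, (iterateFunctor T n).obj M ⟶ M :=
    fun n ↦ Nat.rec (𝟙 M) (fun n q ↦
      @inv _ _ _ _ (η.app ((iterateFunctor T n).obj M)) (this n) ≫ q) n
  let c : Cocone ((iterateSequence η).obj M) :=
    { pt := M
      ι := NatTrans.ofSequence p (fun n ↦ by
        dsimp [iterateSequence]
        rw [Functor.ofSequence_map_homOfLE_succ]
        exact (@IsIso.hom_inv_id_assoc _ _ _ _ (η.app ((iterateFunctor T n).obj M))
          (this n) _ _).trans (Category.comp_id _).symm) }
  exact ⟨colimit.desc _ c, colimit.ι_desc c 0⟩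

variable [HasZeroMorphisms A] [T.PreservesZeroMorphisms]

/-- Vanishing propagates along the stages: after composing with the mono `η.app N`, the restriction
of `f` to stage `n + 1` becomes `T` of its restriction to stage `n`. -/
lemma eq_zero_of_iterateUnit_comp_eq_zero {X N : A} [Mono (η.app N)]
    (f : (iterateColimit η).obj X ⟶ N) (hf : iterateUnit η X ≫ f = 0) : f = 0 := by
  refine iterateColimit_hom_ext fun n ↦ ?_
  rw [comp_zero]
  induction n with
  | zero => exact hf
  | succ n ih =>
    rw [← cancel_mono (η.app N), zero_comp, Category.assoc]
    refine (congrArg _ (η.naturality f)).trans ?_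
    dsimp
    rw [reassoc_of% (toIterateColimit_pointing hη)]
    exact (T.map_comp _ _).symm.trans ((congrArg T.map ih).trans (T.map_zero _ _))

lemma isZero_iterateColimit [PreservesColimitsOfShape ℕ T] {X : A} (h : iterateUnit η X = 0) :
    IsZero ((iterateColimit η).obj X) := by
  have := isIso_pointing_iterateColimit hη X
  rw [IsZero.iff_id_eq_zero]
  exact eq_zero_of_iterateUnit_comp_eq_zero hη _ (by rw [h, zero_comp])

end WellPointed

/-! ### Closed objects and the torsion class of a pointing -/

section ClosedObjects

variable {A : Type u} [Category.{v} A] [Abelian A]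

section

variable {P : ObjectProperty A} [P.IsSerreClass]

/-- Torsion-freeness makes `f` vanish on the kernel of `s`, so `f` descends to the image of `s`;
relative injectivity then extends it along the image inclusion. -/
lemma closedObjects.exists_extension {M : A} (hM : closedObjects P M) {X Y : A} (s : X ⟶ Y)
    (hs : P.isoModSerre s) (f : X ⟶ M) : ∃ g : Y ⟶ M, s ≫ g = f := by
  have hk : kernel.ι s ≫ f = 0 := by
    have h : IsZero (image (kernel.ι s ≫ f)) :=
      hM.1 (image.ι _) (P.prop_of_epi (factorThruImage (kernel.ι s ≫ f)) hs.1)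
    rw [← image.fac (kernel.ι s ≫ f), h.eq_of_tgt (factorThruImage _) 0, zero_comp]
  obtain ⟨g, hg⟩ := hM.2 (Abelian.image.ι s)
    (P.prop_of_iso (cokernelIsoOfEq (Abelian.image.fac s).symm ≪≫ cokernelEpiComp _ _) hs.2)
    (Abelian.epiDesc (Abelian.factorThruImage s) f (by
      have : kernel.ι (Abelian.factorThruImage s) ≫ s = 0 := by
        have h := kernel.condition_assoc (Abelian.factorThruImage s) (Abelian.image.ι s)
        rwa [Abelian.image.fac, zero_comp] at h
      rw [← kernel.lift_ι s _ this, Category.assoc, hk, comp_zero]))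
  exact ⟨g, by rw [← Abelian.image.fac s, Category.assoc, hg, Abelian.comp_epiDesc]⟩

/-- Isomorphisms modulo `P` that start at a closed object split, so the denominators in the calculus
of left fractions can be removed; this gives full faithfulness. The envelopes in `h` give essential
surjectivity. -/
lemma isEquivalence_closedToQuotient
    (h : ∀ X : A, ∃ (M : A) (s : X ⟶ M), closedObjects P M ∧ P.isoModSerre s) :
    (closedToQuotient P).IsEquivalence := by
  have retract {M N : A} (hM : closedObjects P M) (s : M ⟶ N) (hs : P.isoModSerre s) :
      ∃ r : N ⟶ M, s ≫ r = 𝟙 M := hM.exists_extension s hs (𝟙 M)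
  have : (closedToQuotient P).Faithful := ⟨fun {M N f g} hfg ↦ by
    obtain ⟨Z, s, hs, fac⟩ := (MorphismProperty.map_eq_iff_postcomp (toQuotient P)
      P.isoModSerre f.hom g.hom).1 hfg
    obtain ⟨r, hr⟩ := retract N.property s hs
    ext
    simpa [hr] using congrArg (· ≫ r) fac⟩
  have : (closedToQuotient P).Full := ⟨fun {M N} f ↦ by
    obtain ⟨φ, hφ⟩ := Localization.exists_leftFraction (toQuotient P) P.isoModSerre f
    obtain ⟨r, hr⟩ := retract N.property φ.s φ.hs
    refine ⟨ObjectProperty.homMk (φ.f ≫ r), ?_⟩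
    have := Localization.inverts (toQuotient P) P.isoModSerre φ.s φ.hs
    rw [hφ, ← cancel_mono ((toQuotient P).map φ.s),
      MorphismProperty.LeftFraction.map_comp_map_s]
    have hr' : (toQuotient P).map r ≫ (toQuotient P).map φ.s = 𝟙 _ := by
      rw [← cancel_epi ((toQuotient P).map φ.s), ← Functor.map_comp_assoc, hr]
      simp
    change (toQuotient P).map (φ.f ≫ r) ≫ _ = _
    rw [Functor.map_comp, Category.assoc, hr', Category.comp_id]⟩
  have : (closedToQuotient P).EssSurj := ⟨fun Y ↦ by
    have := Localization.essSurj (toQuotient P) P.isoModSerre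
    obtain ⟨M, s, hM, hs⟩ := h ((toQuotient P).objPreimage Y)
    have := Localization.inverts (toQuotient P) P.isoModSerre s hs
    exact ⟨⟨M, hM⟩, ⟨(asIso ((toQuotient P).map s)).symm ≪≫ (toQuotient P).objObjPreimageIso Y⟩⟩⟩
  exact { }

end

lemma hasExactColimitsOfShape_nat [IsGrothendieckAbelian.{w} A] :
    ∃ _ : HasColimitsOfShape ℕ A, HasExactColimitsOfShape ℕ A := by
  have : HasFilteredColimitsOfSize.{0, 0} A := hasFilteredColimitsOfSize_of_univLE.{0, 0, w, w}
  have : AB5OfSize.{0, 0} A := AB5OfSize_of_univLE.{0, 0, w, w} A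
  exact ⟨inferInstance, inferInstance⟩

variable {T : A ⥤ A} (η : 𝟭 A ⟶ T)

/-- The objects at which the pointing of an endofunctor vanishes. -/
def pointingKernel : ObjectProperty A := fun X ↦ η.app X = 0

variable [HasColimitsOfShape ℕ A]

/-- The objects at which the unit of the colimit of the iterates vanishes. -/
def iterateTorsion : ObjectProperty A := fun X ↦ iterateUnit η X = 0

variable [HasExactColimitsOfShape ℕ A] [PreservesFiniteLimits T] [PreservesColimitsOfShape ℕ T]

instance : (iterateColimit η).PreservesZeroMorphisms :=
  Functor.preservesZeroMorphisms_of_preserves_terminal_object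

variable {η}

omit [HasExactColimitsOfShape ℕ A] [PreservesFiniteLimits T] [PreservesColimitsOfShape ℕ T] in
lemma pointingKernel_le_iterateTorsion : pointingKernel η ≤ iterateTorsion η := fun X hX ↦
  (pointing_toIterateColimit η 0 X).symm.trans ((congrArg (· ≫ _) hX).trans zero_comp)

omit [PreservesColimitsOfShape ℕ T] in
lemma iterateTorsion_of_mono {X Y : A} (f : X ⟶ Y) [Mono f] (hY : iterateTorsion η Y) :
    iterateTorsion η X := by
  change _ = _
  rw [← cancel_mono ((iterateColimit η).map f), iterateUnit_naturality, hY, comp_zero, zero_comp]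

variable (hη : ∀ X, T.map (η.app X) = η.app (T.obj X))

include hη

/-- The colimit functor is left exact and kills `Z`, so the image of `f` is the kernel of a zero
morphism and the identity lifts through it. -/
lemma exists_lift_iterateColimit {X Y Z : A} {f : X ⟶ Y} {g : Y ⟶ Z} {w : f ≫ g = 0}
    (hf : IsLimit (KernelFork.ofι f w)) (hZ : iterateTorsion η Z) :
    ∃ t : (iterateColimit η).obj Y ⟶ (iterateColimit η).obj X,
      t ≫ (iterateColimit η).map f = 𝟙 _ := by
  have : T.PreservesZeroMorphisms := Functor.preservesZeroMorphisms_of_preserves_terminal_object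
  obtain ⟨t, ht⟩ := KernelFork.IsLimit.lift' (KernelFork.mapIsLimit _ hf (iterateColimit η)) (𝟙 _)
    ((isZero_iterateColimit hη hZ).eq_of_tgt _ _)
  exact ⟨t, ht⟩

lemma isLocalizing_iterateTorsion : IsLocalizing.{w} (iterateTorsion η) where
  exists_zero := ⟨_, isZero_zero A, (isZero_zero A).eq_of_src _ _⟩
  prop_of_mono f _ hY := iterateTorsion_of_mono f hY
  prop_of_epi {X Y} f _ hX := by
    change _ = _
    rw [← cancel_epi f, ← iterateUnit_naturality, hX, comp_zero, zero_comp]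
  prop_X₂_of_shortExact {S} hS h₁ h₃ := by
    have := hS.mono_f
    have : T.PreservesZeroMorphisms := Functor.preservesZeroMorphisms_of_preserves_terminal_object
    -- The unit at the middle term factors through the colimit at `S.X₁`, which is zero.
    obtain ⟨t, ht⟩ := exists_lift_iterateColimit hη hS.fIsKernel h₃
    change _ = _
    rw [← Category.comp_id (iterateUnit η S.X₂), ← ht,
      (isZero_iterateColimit hη h₁).eq_of_tgt t 0, zero_comp, comp_zero]
  closedUnderDirectSums J := ⟨fun X ⟨hX⟩ ↦ hX.isColimit.hom_ext fun j ↦ by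
    refine (iterateUnit_naturality η (hX.ι.app j)).symm.trans ?_
    rw [hX.prop_diag_obj j, zero_comp, comp_zero]⟩

/-- Since `M` is a retract of its iterate colimit via the unit, both conditions can be tested after
applying `iterateColimit η`, which kills `P` and inverts monomorphisms with cokernel in `P`. -/
lemma closedObjects_of_isIso_pointing {P : ObjectProperty A} (hP : P ≤ iterateTorsion η) (M : A)
    [IsIso (η.app M)] : closedObjects P M := by
  obtain ⟨r, hr⟩ := exists_iterateUnit_retraction hη M
  refine ⟨fun X i _ hX ↦ ?_, fun X' X i _ hi f ↦ ?_⟩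
  · have : i = 0 := by
      rw [← Category.comp_id i, ← hr, ← reassoc_of% (iterateUnit_naturality η), hP _ hX, zero_comp]
    exact IsZero.of_mono_eq_zero i this
  · obtain ⟨t, ht⟩ := exists_lift_iterateColimit hη
      (Abelian.monoIsKernelOfCokernel _ (cokernelIsCokernel i)) (hP _ hi)
    have ht' : (iterateColimit η).map i ≫ t = 𝟙 _ := by
      rw [← cancel_mono ((iterateColimit η).map i), Category.assoc]
      refine (congrArg _ ht).trans ?_
      simp
    refine ⟨iterateUnit η X ≫ t ≫ (iterateColimit η).map f ≫ r, ?_⟩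
    rw [← reassoc_of% (iterateUnit_naturality η), reassoc_of% ht',
      reassoc_of% (iterateUnit_naturality η), hr, Category.comp_id]

omit [HasColimitsOfShape ℕ A] [HasExactColimitsOfShape ℕ A] [PreservesFiniteLimits T]
  [PreservesColimitsOfShape ℕ T] in
lemma pointingKernel_cokernel (M : A) [T.PreservesZeroMorphisms] :
    pointingKernel η (cokernel (η.app M)) := by
  change _ = _
  rw [← cancel_epi (cokernel.π (η.app M))]
  refine (η.naturality (cokernel.π (η.app M))).trans ?_
  rw [← hη, comp_zero, ← T.map_comp, cokernel.condition, T.map_zero]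

omit hη [HasColimitsOfShape ℕ A] [HasExactColimitsOfShape ℕ A]
  [PreservesColimitsOfShape ℕ T] in
lemma pointingKernel_kernel (M : A) : pointingKernel η (kernel (η.app M)) := by
  change _ = _
  rw [← cancel_mono (T.map (kernel.ι (η.app M))), zero_comp]
  exact (η.naturality (kernel.ι (η.app M))).symm.trans (kernel.condition _)

omit [HasColimitsOfShape ℕ A] [HasExactColimitsOfShape ℕ A]
  [PreservesColimitsOfShape ℕ T] in
-- The kernel and cokernel of `η.app M` lie in `P`, so it is a mono with a retraction `r`.
-- Naturality at `r` and `T η = η T` turn `r` into a two-sided inverse.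
lemma isIso_pointing_of_closedObjects {P : ObjectProperty A} (hP : pointingKernel η ≤ P) {M : A}
    (hM : closedObjects P M) : IsIso (η.app M) := by
  have : T.PreservesZeroMorphisms := Functor.preservesZeroMorphisms_of_preserves_terminal_object
  have : Mono (η.app M) := Preadditive.mono_of_isZero_kernel _
    (hM.1 (kernel.ι (η.app M)) (hP _ (pointingKernel_kernel M)))
  obtain ⟨r, hr⟩ := hM.2 (η.app M) (hP _ (pointingKernel_cokernel hη M)) (𝟙 M)
  refine ⟨r, hr, ?_⟩
  refine (η.naturality r).trans ?_
  rw [← hη, ← T.map_comp, hr]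
  exact T.map_id M

omit hη [PreservesColimitsOfShape ℕ T] in
lemma iterateTorsion_le_of_isLocalizing {P : ObjectProperty A} [IsLocalizing.{w} P]
    [HasColimitsOfShape (Discrete (ULift.{w} ℕ)) A]
    (hP : pointingKernel η ≤ P) : iterateTorsion η ≤ P := by
  intro Z hZ
  -- `α.app n` is the composite `Z ⟶ Tⁿ Z`. Its kernel lies in `P`, because each step has its kernel
  -- in `pointingKernel η` and `P` is closed under extensions.
  let α : (Functor.const ℕ).obj Z ⟶ (iterateSequence η).obj Z :=
    NatTrans.ofSequence (fun n ↦ Nat.rec (𝟙 Z) (fun n q ↦ q ≫ iterateStep η n Z) n) (fun n ↦ by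
      dsimp [iterateSequence]
      rw [Functor.ofSequence_map_homOfLE_succ]
      exact Category.id_comp _)
  have hα (n : ℕ) : P.monoModSerre (α.app n) := by
    induction n with
    | zero => exact P.monoModSerre_of_mono (𝟙 Z)
    | succ n ih =>
      exact P.monoModSerre.comp_mem _ (iterateStep η n Z) ih (hP _ (pointingKernel_kernel _))
  have hα_unit (n : ℕ) : α.app n ≫ toIterateColimit η n Z = 0 := by
    induction n with
    | zero => exact (Category.id_comp _).trans hZ
    | succ n ih =>
      refine (Category.assoc _ _ _).trans (Eq.trans ?_ ih)
      exact congrArg (α.app n ≫ ·) (pointing_toIterateColimit η n Z)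
  have hα₀ : colim.map α = 0 := colimit.hom_ext fun n ↦ by
    rw [comp_zero]
    exact (ι_colimMap _ _).trans (hα_unit n)
  -- By exactness this map is a kernel of `colim.map α = 0`.
  have hepi : Epi (colim.map (kernel.ι α)) := by
    obtain ⟨t, ht⟩ := KernelFork.IsLimit.lift'
      (KernelFork.mapIsLimit _ (kernelIsKernel α) colim) (𝟙 _) (by rw [hα₀, comp_zero])
    exact epi_of_epi_fac ht
  -- `Z` is thus a quotient of the direct sum of the kernels. The index is lifted to universe `w`,
  -- where direct sums in `IsLocalizing` are indexed.
  have : Epi (Sigma.desc (fun n : ULift.{w} ℕ ↦ kernel.ι (α.app n.down))) := by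
    refine Preadditive.epi_of_cancel_zero _ fun {W} g hg ↦ ?_
    have hg' (n : ℕ) : kernel.ι (α.app n) ≫ g = 0 := by
      have := congrArg (Sigma.ι (fun n : ULift.{w} ℕ ↦ kernel (α.app n.down)) ⟨n⟩ ≫ ·) hg
      simpa using this
    let d : colim.obj ((Functor.const ℕ).obj Z) ⟶ W :=
      colimit.desc _ ⟨W, { app := fun _ ↦ g }⟩
    have hd (n : ℕ) : colimit.ι ((Functor.const ℕ).obj Z) n ≫ d = g := colimit.ι_desc _ _
    have hd₀ : d = 0 := by
      rw [← cancel_epi (colim.map (kernel.ι α)), comp_zero]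
      refine colimit.hom_ext fun n ↦ ?_
      rw [comp_zero]
      refine (ι_colimMap_assoc _ _ _).trans ?_
      rw [hd]
      have h : (kernel.ι α).app n ≫ α.app n = 0 := by
        rw [← NatTrans.comp_app, kernel.condition, zero_app]
      rw [← kernel.lift_ι _ _ h, Category.assoc, hg', comp_zero]
    rw [← hd 0, hd₀, comp_zero]
  have := IsLocalizing.closedUnderDirectSums (P := P) (ULift.{w} ℕ)
  exact P.prop_of_epi (Sigma.desc (fun n : ULift.{w} ℕ ↦ kernel.ι (α.app n.down)))
    (P.prop_colimit _ fun n ↦ hα n.as.down)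

/-- The kernel is torsion because the colimit functor preserves monos. The unit of the cokernel
vanishes because it is tested on the colimit at `X`, where vanishing after `iterateUnit η X`
suffices. -/
lemma isoModSerre_iterateUnit {P : ObjectProperty A} [P.IsSerreClass] (hP : iterateTorsion η ≤ P)
    (X : A) : P.isoModSerre (iterateUnit η X) := by
  have : T.PreservesZeroMorphisms := Functor.preservesZeroMorphisms_of_preserves_terminal_object
  refine ⟨hP _ ?_, hP _ ?_⟩
  · change _ = _
    rw [← cancel_mono ((iterateColimit η).map (kernel.ι (iterateUnit η X))),
      iterateUnit_naturality, kernel.condition, zero_comp]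
  · change _ = _
    have := isIso_pointing_iterateColimit hη (cokernel (iterateUnit η X))
    rw [← cancel_epi (cokernel.π (iterateUnit η X)), comp_zero]
    exact eq_zero_of_iterateUnit_comp_eq_zero hη _ (by rw [cokernel.condition_assoc, zero_comp])

end ClosedObjects

/-! ### The localizing closure in a Grothendieck category -/

section Grothendieck

variable {A : Type u} [Category.{v} A] [Abelian A] [IsGrothendieckAbelian.{w} A]
  {T : A ⥤ A} {η : 𝟭 A ⟶ T} [PreservesFiniteLimits T] [PreservesFilteredColimitsOfSize.{w, w} T]
  (hη : ∀ X, T.map (η.app X) = η.app (T.obj X))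

include hη

lemma closedObjects_localizingClosure_iff (M : A) :
    closedObjects (localizingClosure.{w} (pointingKernel η)) M ↔ IsIso (η.app M) := by
  obtain ⟨_, _⟩ := hasExactColimitsOfShape_nat.{w} (A := A)
  have := preservesSmallestFilteredColimits_of_preservesFilteredColimits.{w, w} T
  have := isLocalizing_iterateTorsion.{w} hη
  exact ⟨isIso_pointing_of_closedObjects hη (le_localizingClosure _),
    fun _ ↦ closedObjects_of_isIso_pointing hη
      (localizingClosure_le _ _ pointingKernel_le_iterateTorsion) M⟩

lemma isEquivalence_closedToQuotient_localizingClosure :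
    (closedToQuotient (localizingClosure.{w} (pointingKernel η))).IsEquivalence := by
  obtain ⟨_, _⟩ := hasExactColimitsOfShape_nat.{w} (A := A)
  have := preservesSmallestFilteredColimits_of_preservesFilteredColimits.{w, w} T
  refine isEquivalence_closedToQuotient fun X ↦ ⟨_, iterateUnit η X,
    (closedObjects_localizingClosure_iff hη _).2 (isIso_pointing_iterateColimit hη X),
    isoModSerre_iterateUnit hη
      (iterateTorsion_le_of_isLocalizing.{w} (le_localizingClosure _)) X⟩

end Grothendieck

end WideMorita

/-! ### The equivalence attached to a Morita context -/

theorem mainTheorem3 {A : Type u₁} [Category.{v₁} A] [Abelian A] [IsGrothendieckAbelian.{w} A]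
    {B : Type u₂} [Category.{v₂} B] [Abelian B] [IsGrothendieckAbelian.{w} B]
    (Γ : WideMorita.LeftWideMoritaContext A B)
    (hF : PreservesFilteredColimitsOfSize.{w, w} Γ.F)
    (hG : PreservesFilteredColimitsOfSize.{w, w} Γ.G) :
    -- the closed objects are models of the quotient categories
    (WideMorita.closedToQuotient Γ.Cbar.{w}).IsEquivalence ∧
    (WideMorita.closedToQuotient Γ.Dbar.{w}).IsEquivalence ∧
    -- `G` and `F` restrict to the closed objects
    ∃ (hGc : ∀ M : (WideMorita.closedObjects Γ.Cbar.{w}).FullSubcategory,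
          WideMorita.closedObjects Γ.Dbar.{w} (Γ.G.obj M.obj))
      (hFc : ∀ N : (WideMorita.closedObjects Γ.Dbar.{w}).FullSubcategory,
          WideMorita.closedObjects Γ.Cbar.{w} (Γ.F.obj N.obj))
      -- the restrictions of `G` and `F` are mutually inverse equivalences
      (e : (WideMorita.closedObjects Γ.Cbar.{w}).FullSubcategory ≌
          (WideMorita.closedObjects Γ.Dbar.{w}).FullSubcategory)
      -- the induced equivalence of the quotient categories
      (Φ : WideMorita.QuotientCategory Γ.Cbar.{w} ≌ WideMorita.QuotientCategory Γ.Dbar.{w}),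
      e.functor = (WideMorita.closedObjects Γ.Dbar.{w}).lift
          ((WideMorita.closedObjects Γ.Cbar.{w}).ι ⋙ Γ.G) hGc ∧
      e.inverse = (WideMorita.closedObjects Γ.Cbar.{w}).lift
          ((WideMorita.closedObjects Γ.Dbar.{w}).ι ⋙ Γ.F) hFc ∧
      Nonempty (WideMorita.closedToQuotient Γ.Cbar.{w} ⋙ Φ.functor ≅
          e.functor ⋙ WideMorita.closedToQuotient Γ.Dbar.{w}) ∧
      Nonempty (WideMorita.closedToQuotient Γ.Dbar.{w} ⋙ Φ.inverse ≅
          e.inverse ⋙ WideMorita.closedToQuotient Γ.Cbar.{w}) := by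
  have := Γ.leftExact_F
  have := Γ.leftExact_G
  have hη (X : A) : (Γ.G ⋙ Γ.F).map (Γ.η.app X) = Γ.η.app ((Γ.G ⋙ Γ.F).obj X) :=
    (congrArg Γ.F.map (Γ.map_η X)).trans (Γ.map_ρ _)
  have hρ (Y : B) : (Γ.F ⋙ Γ.G).map (Γ.ρ.app Y) = Γ.ρ.app ((Γ.F ⋙ Γ.G).obj Y) :=
    (congrArg Γ.G.map (Γ.map_ρ Y)).trans (Γ.map_η _)
  have hC := WideMorita.closedObjects_localizingClosure_iff.{w} hη
  have hD := WideMorita.closedObjects_localizingClosure_iff.{w} hρ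
  have hA : (WideMorita.closedToQuotient Γ.Cbar.{w}).IsEquivalence :=
    WideMorita.isEquivalence_closedToQuotient_localizingClosure.{w} hη
  have hB : (WideMorita.closedToQuotient Γ.Dbar.{w}).IsEquivalence :=
    WideMorita.isEquivalence_closedToQuotient_localizingClosure.{w} hρ
  have hGc (M : (WideMorita.closedObjects Γ.Cbar.{w}).FullSubcategory) :
      WideMorita.closedObjects Γ.Dbar.{w} (Γ.G.obj M.obj) := by
    have := (hC M.obj).1 M.property
    refine (hD _).2 ?_
    -- `ρ` at `G M` is `G` of the isomorphism `η.app M`.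
    rw [← Γ.map_η]
    infer_instance
  have hFc (N : (WideMorita.closedObjects Γ.Dbar.{w}).FullSubcategory) :
      WideMorita.closedObjects Γ.Cbar.{w} (Γ.F.obj N.obj) := by
    have := (hD N.obj).1 N.property
    refine (hC _).2 ?_
    rw [← Γ.map_ρ]
    infer_instance
  let e : (WideMorita.closedObjects Γ.Cbar.{w}).FullSubcategory ≌
      (WideMorita.closedObjects Γ.Dbar.{w}).FullSubcategory :=
    CategoryTheory.Equivalence.mk
      ((WideMorita.closedObjects Γ.Dbar.{w}).lift
        ((WideMorita.closedObjects Γ.Cbar.{w}).ι ⋙ Γ.G) hGc)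
      ((WideMorita.closedObjects Γ.Cbar.{w}).lift
        ((WideMorita.closedObjects Γ.Dbar.{w}).ι ⋙ Γ.F) hFc)
      (NatIso.ofComponents (fun M ↦
        have := (hC M.obj).1 M.property
        ObjectProperty.isoMk _ (asIso (Γ.η.app M.obj))) (fun f ↦ by
          ext
          exact Γ.η.naturality f.hom))
      (NatIso.ofComponents (fun N ↦
        have := (hD N.obj).1 N.property
        ObjectProperty.isoMk _ (asIso (Γ.ρ.app N.obj))) (fun f ↦ by
          ext
          exact Γ.ρ.naturality f.hom)).symm
  let eA := (WideMorita.closedToQuotient Γ.Cbar.{w}).asEquivalence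
  let eB := (WideMorita.closedToQuotient Γ.Dbar.{w}).asEquivalence
  -- The equivalence of quotients is `e` transported along the two equivalences with closed objects.
  refine ⟨hA, hB, hGc, hFc, e, eA.symm.trans (e.trans eB), rfl, rfl, ⟨?_⟩, ⟨?_⟩⟩
  · exact Functor.isoWhiskerRight eA.unitIso.symm (e.functor ⋙ eB.functor)
  · exact Functor.isoWhiskerRight eB.unitIso.symm (e.inverse ⋙ eA.functor)
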